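/- All graphs are finite and simple. Let $G=(V,E)$ be a graph. Its independence number $\beta(G)$ is the maximum cardinality of a set of pairwise non-adjacent vertices. A set $D\subseteq V$ is dominating if every vertex of $V\setminus D$ has a neighbour in $D$; the connected domination number $\gamma_c(G)$ of a connected graph $G$ is the minimum cardinality of a dominating set $D$ for which the induced subgraph $G[D]$ is connected (and non-empty). The $m$-eternal domination number $\gamma_{\mathrm m}^{\infty}(G)$ is the least number of guards with which the defender wins the following game. The defender places guards on the vertices of a set $D_1$, one guard per vertex. In round $i\ge 1$ the attacker, knowing $D_i$, attacks a vertex $r_i\in V\setminus D_i$, and the defender answers with a set $D_{i+1}$ containing $r_i$, obtained from $D_i$ by letting every guard stay where it is or move to an adjacent vertex, with at most one guard on each vertex afterwards. The defender wins if they can respond to every (adaptively chosen) sequence of attacks, with all the sets $D_1,D_2,\ldots$ dominating. A neo-colonization of $G$ is a partition $\{V_1,\ldots,V_t\}$ of $V$ into non-empty parts such that each induced subgraph $G[V_i]$ is connected. The weight of a part $V_i$ is $1$ if $V_i$ induces a clique, and $1+\gamma_c(G[V_i])$ otherwise; the weight of the neo-colonization is the sum of the weights of its parts. It is of minimum weight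 if no neo-colonization of $G$ has smaller weight. **Corollary.** Let $T$ be a tree with at least two vertices. Then $\gamma_{\mathrm m}^{\infty}(T)=\beta(T)$ if and only if there exists a minimum-weight neo-colonization of $T$ in which every part induces a $K_2$ or a $P_3$ (the path on three vertices) and at most one part induces a $P_3$. -/

import Mathlib

namespace EternalDomination

/-- `D` is a dominating set of `G`: every vertex outside `D` has a neighbour in `D`. -/
def IsDominating {V : Type*} (G : SimpleGraph V) (D : Finset V) : Prop :=
  ∀ u, u ∉ D → ∃ x ∈ D, G.Adj x u

/-- The connected domination number `γ_c(G)`: the minimum cardinality of a dominating set that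
induces a connected subgraph. -/
noncomputable def connDomNum {V : Type*} (G : SimpleGraph V) : ℕ :=
  sInf {k | ∃ D : Finset V, IsDominating G D ∧ (G.induce (D : Set V)).Connected ∧ D.card = k}

/-- The guards standing on `D` (one per vertex) can relocate to `D'`, each guard staying where it
is or moving along one edge, with at most one guard per vertex afterwards. -/
def CanMove {V : Type*} (G : SimpleGraph V) (D D' : Finset V) : Prop :=
  ∃ f : V → V, Set.BijOn f (D : Set V) (D' : Set V) ∧ ∀ v ∈ D, f v = v ∨ G.Adj v (f v)

/-- A defender strategy `σ` assigns to every finite history of attacks (most recent attack first)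
the set of vertices occupied by guards after that history. `LegalHistory σ h` says that every
attack in `h` was made on a vertex that was unoccupied at that time. -/
inductive LegalHistory {V : Type*} (σ : List V → Finset V) : List V → Prop
  | nil : LegalHistory σ []
  | cons {h : List V} {r : V} : LegalHistory σ h → r ∉ σ h → LegalHistory σ (r :: h)

/-- The strategy `σ` defends `G` forever against all adaptively chosen attacks, in the version of
the game where all guards may move. -/
def IsWinning {V : Type*} (G : SimpleGraph V) (σ : List V → Finset V) : Prop :=
  ∀ h, LegalHistory σ h →
    IsDominating G (σ h) ∧ ∀ r, r ∉ σ h → CanMove G (σ h) (σ (r :: h)) ∧ r ∈ σ (r :: h)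

/-- The `m`-eternal domination number: the least number of guards with which the defender wins. -/
noncomputable def mEternalDomNum {V : Type*} (G : SimpleGraph V) : ℕ :=
  sInf {k | ∃ σ : List V → Finset V, IsWinning G σ ∧ (σ []).card = k}

/-- A neo-colonization: a partition of the vertex set into parts inducing connected subgraphs. -/
def IsNeoColonization {V : Type*} [Fintype V] [DecidableEq V] (G : SimpleGraph V)
    (P : Finpartition (Finset.univ : Finset V)) : Prop :=
  ∀ A ∈ P.parts, (G.induce (A : Set V)).Connected

open Classical in
/-- The weight of a part: `1` for a clique and `1 + γ_c(G[A])` otherwise. -/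
noncomputable def partWeight {V : Type*} (G : SimpleGraph V) (A : Finset V) : ℕ :=
  if G.IsClique (A : Set V) then 1 else 1 + connDomNum (G.induce (A : Set V))

/-- The total weight of a partition. -/
noncomputable def weight {V : Type*} [Fintype V] [DecidableEq V] (G : SimpleGraph V)
    (P : Finpartition (Finset.univ : Finset V)) : ℕ :=
  ∑ A ∈ P.parts, partWeight G A

/-- A neo-colonization of minimum weight. -/
def IsMinWeightNeoColonization {V : Type*} [Fintype V] [DecidableEq V] (G : SimpleGraph V)
    (P : Finpartition (Finset.univ : Finset V)) : Prop :=
  IsNeoColonization G P ∧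
    ∀ Q : Finpartition (Finset.univ : Finset V), IsNeoColonization G Q → weight G P ≤ weight G Q

/-- The subgraph induced by `A` is a `K₂`. -/
def InducesK2 {V : Type*} (G : SimpleGraph V) (A : Finset V) : Prop :=
  Nonempty (G.induce (A : Set V) ≃g (⊤ : SimpleGraph (Fin 2)))

/-- The subgraph induced by `A` is a `P₃`, the path on three vertices. -/
def InducesP3 {V : Type*} (G : SimpleGraph V) (A : Finset V) : Prop :=
  Nonempty (G.induce (A : Set V) ≃g SimpleGraph.pathGraph 3)

end EternalDomination

/-! Write β for the independence number. The proof has two halves. First, on a tree the m-eternal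
domination number equals the minimum weight of a neo-colonization. For the upper bound, parts are
defended independently: one guard walks around a clique; otherwise a connected dominating set is
kept occupied and one extra guard is replaced by shifting guards along a path
(`IsConnDomOn.exists_guardable`). For the lower bound, peel the tree. A tree on at least three
vertices has a vertex with at least two leaf neighbours and at most one other neighbour, or a vertex
of degree two with exactly one leaf neighbour or two (one chosen as the leaf). Delete the leaves in
the first case, the vertex and the chosen leaf in the second: a strategy for the tree yields one for
the rest with one guard fewer (`Defendable.reduce`), while a colonization of the rest extends with
one more unit of weight. Strategies on smaller trees may stack guards, so the induction uses a game
that allows this. Second, the same peeling compares weights with β (`colonization_indepNumOn`):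
either some colonization weighs less than β, or the tree is a single vertex or splits into edges and
at most one P₃. Conversely, such a split has weight exactly β, since a part contains at most its
weight many independent vertices and `card ≤ 2β` gives the other bound by rounding. -/

namespace EternalDomination

/-! ### Leaves and stems of subtrees -/

section Connectivity

variable {V : Type*} {G : SimpleGraph V}

lemma connected_induce_induce_iff (A : Set V) (D : Set A) :
    ((G.induce A).induce D).Connected ↔ (G.induce (Subtype.val '' D)).Connected := by
  let e : (G.induce A).induce D ≃g G.induce (Subtype.val '' D) :=
    { toFun := fun x => ⟨x.1.1, x.1, x.2, rfl⟩
      invFun := fun y => ⟨⟨y.1, by obtain ⟨y, z, hz, rfl⟩ := y; exact z.2⟩,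
        by obtain ⟨y, z, hz, rfl⟩ := y; exact hz⟩
      left_inv := fun x => rfl
      right_inv := fun y => rfl
      map_rel_iff' := Iff.rfl }
  exact e.connected_iff

lemma exists_adj_of_connected {S : Finset V} (hS : (G.induce (S : Set V)).Connected)
    (hc : 2 ≤ S.card) {w : V} (hw : w ∈ S) : ∃ x ∈ S, G.Adj w x := by
  have : Nontrivial (S : Set V) := by
    have := Finset.one_lt_card_iff_nontrivial.1 hc
    exact Set.nontrivial_coe_sort.2 this
  obtain ⟨x, hx⟩ := hS.preconnected.exists_adj_of_nontrivial ⟨w, hw⟩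
  exact ⟨x.1, x.2, hx⟩

lemma exists_leaf (hG : G.IsAcyclic) {S : Finset V} (hS : (G.induce (S : Set V)).Connected)
    (hc : 2 ≤ S.card) : ∃ l ∈ S, ∃ v ∈ S, G.Adj l v ∧ ∀ x ∈ S, G.Adj l x → x = v := by
  classical
  have : Nontrivial (S : Set V) := by
    have := Finset.one_lt_card_iff_nontrivial.1 hc
    exact Set.nontrivial_coe_sort.2 this
  obtain ⟨l, hl⟩ := (SimpleGraph.IsTree.mk hS (hG.induce _)).exists_vert_degree_one_of_nontrivial
  obtain ⟨v, hv, huniq⟩ := SimpleGraph.degree_eq_one_iff_existsUnique_adj.1 hl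
  exact ⟨l.1, l.2, v.1, v.2, hv, fun x hx hlx => congrArg Subtype.val (huniq ⟨x, hx⟩ hlx)⟩

variable [DecidableEq V]

lemma connected_sdiff_of_leaves {S L : Finset V} (hS : (G.induce (S : Set V)).Connected)
    (hL : ∀ w ∈ L, ∀ x ∈ S, ∀ y ∈ S, G.Adj w x → G.Adj w y → x = y) (hne : (S \ L).Nonempty) :
    (G.induce ((S \ L : Finset V) : Set V)).Connected := by
  have h := hS.preconnected.induce_of_degree_eq_one (s := {x : (S : Set V) | x.1 ∉ L}) (by
    intro v hv x hx y hy
    simp only [Set.mem_ofPred_eq, not_not] at hv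
    exact Subtype.ext (hL v.1 hv x.1 x.2 y.1 y.2 hx hy))
  obtain ⟨a, ha⟩ := hne
  rw [Finset.mem_sdiff] at ha
  have : Nonempty {x : (S : Set V) | x.1 ∉ L} := ⟨⟨⟨a, ha.1⟩, ha.2⟩⟩
  have h2 := (connected_induce_induce_iff (G := G) _ _).1 (SimpleGraph.Connected.mk h)
  convert h2 using 2
  all_goals
    ext x
    simp [and_comm]

/-- Plays the role of the second vertex of a longest path. The induction deletes a leaf `l` with
neighbour `s` and checks whether restoring `l` spoils the stem found in the rest. The exceptional
vertex `u` need not be a neighbour of `v`. -/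
lemma exists_stem (hG : G.IsAcyclic) {S : Finset V} (hS : (G.induce (S : Set V)).Connected)
    (hc : 2 ≤ S.card) : ∃ v ∈ S, ∃ u, ∃ l ∈ S, l ≠ u ∧ G.Adj v l ∧
      ∀ w ∈ S, G.Adj v w → w = u ∨ ∀ x ∈ S, G.Adj w x → x = v := by
  induction h : S.card using Nat.strong_induction_on generalizing S with
  | _ n ih =>
  subst h
  obtain ⟨l, hl, s, hs, hls, huniq⟩ := exists_leaf hG hS hc
  have hne : l ≠ s := hls.ne
  rcases hc.eq_or_lt with h2 | h3
  -- For a single edge no exceptional neighbour exists, so `s` itself is a dummy value.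
  · refine ⟨s, hs, s, l, hl, hne, hls.symm, fun w hw hsw => Or.inr ?_⟩
    have hS2 : ({l, s} : Finset V) = S :=
      Finset.eq_of_subset_of_card_le (by grind) (by rw [Finset.card_pair hne]; omega)
    have : w = l := by
      have := hsw.ne
      grind
    exact this ▸ huniq
  · have hcard : (S.erase l).card = S.card - 1 := Finset.card_erase_of_mem hl
    have hconn : (G.induce ((S.erase l : Finset V) : Set V)).Connected := by
      rw [Finset.erase_eq]
      refine connected_sdiff_of_leaves hS ?_ ⟨s, by grind⟩
      intro w hw x hx y hy hwx hwy
      obtain rfl := Finset.mem_singleton.1 hw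
      rw [huniq x hx hwx, huniq y hy hwy]
    obtain ⟨v, hv, u, m, hm, hmu, hvm, hall⟩ := ih (S.erase l).card (by omega) hconn (by omega) rfl
    rw [Finset.mem_erase] at hv hm
    -- Only in this case does restoring `l` turn a leaf at `v` into a non-leaf. Then `s` has no
    -- neighbours but `v` and `l`, so `s` is the new stem.
    by_cases hsv : G.Adj v s ∧ s ≠ u
    · refine ⟨s, hs, v, l, hl, hv.1.symm, hls.symm, fun w hw hsw => ?_⟩
      by_cases hwl : w = l
      · exact Or.inr (hwl ▸ huniq)
      · left
        rcases hall s (by grind) hsv.1 with h | h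
        · exact absurd h hsv.2
        · exact h w (by grind) hsw
    · refine ⟨v, hv.2, u, m, hm.2, hmu, hvm, fun w hw hvw => ?_⟩
      by_cases hwl : w = l
      · subst hwl
        right
        have := huniq v hv.2 hvw.symm
        subst this
        exact huniq
      · rcases hall w (by grind) hvw with h | h
        · exact Or.inl h
        · by_cases hwu : w = u
          · exact Or.inl hwu
          right
          intro x hx hwx
          by_cases hxl : x = l
          · subst hxl
            have := huniq w hw hwx.symm
            subst this
            exact absurd ⟨hvw, hwu⟩ hsv
          · exact h x (by grind) hwx

end Connectivity

/-! ### Weights of connected parts -/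

section Weight

variable {V : Type*} {G : SimpleGraph V}

/-- `C` is a connected dominating set of the subgraph induced by `A`. -/
structure IsConnDomOn (G : SimpleGraph V) (A C : Finset V) : Prop where
  subset : C ⊆ A
  dominates : ∀ u ∈ A, u ∉ C → ∃ x ∈ C, G.Adj x u
  connected : (G.induce (C : Set V)).Connected

lemma IsConnDomOn.exists_induce {A C : Finset V} (h : IsConnDomOn G A C) :
    ∃ D : Finset (A : Set V), IsDominating (G.induce (A : Set V)) D ∧
      ((G.induce (A : Set V)).induce (D : Set (A : Set V))).Connected ∧ D.card = C.card := by
  classical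
  let e : (C : Set V) ↪ (A : Set V) := Set.embeddingOfSubset _ _ (by exact_mod_cast h.subset)
  let D : Finset (A : Set V) := C.attach.map e
  have hD : ∀ x : (A : Set V), x ∈ D ↔ x.1 ∈ C := by
    intro x
    refine ⟨fun hx => ?_, fun hx => Finset.mem_map.2 ⟨⟨x.1, hx⟩, Finset.mem_attach _ _, rfl⟩⟩
    obtain ⟨c, -, rfl⟩ := Finset.mem_map.1 hx
    exact c.2
  refine ⟨D, ?_, ?_, by simp [D]⟩
  · intro u hu
    obtain ⟨x, hx, hxu⟩ := h.dominates u.1 u.2 (fun hc => hu ((hD u).2 hc))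
    exact ⟨⟨x, h.subset hx⟩, (hD _).2 hx, hxu⟩
  · rw [connected_induce_induce_iff]
    convert h.connected using 2
    all_goals
      ext x
      simp only [Set.mem_image, Finset.mem_coe]
      exact ⟨fun ⟨y, hy, hyx⟩ => hyx ▸ (hD y).1 hy, fun hx => ⟨⟨x, h.subset hx⟩, (hD _).2 hx, rfl⟩⟩

lemma partWeight_of_isClique {A : Finset V} (h : G.IsClique (A : Set V)) : partWeight G A = 1 := by
  simp [partWeight, h]

lemma partWeight_le_of_isConnDomOn {A C : Finset V} (h : IsConnDomOn G A C) :
    partWeight G A ≤ 1 + C.card := by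
  unfold partWeight
  split_ifs
  · omega
  · exact Nat.add_le_add_left (Nat.sInf_le h.exists_induce) 1

/-- The infimum defining `connDomNum` is attained, because `A` itself is a candidate. -/
lemma exists_isConnDomOn_of_connected {A : Finset V} (hA : (G.induce (A : Set V)).Connected)
    (hn : ¬ G.IsClique (A : Set V)) : ∃ C, IsConnDomOn G A C ∧ partWeight G A = 1 + C.card := by
  have hself : IsConnDomOn G A A := ⟨subset_rfl, fun u hu hn => absurd hu hn, hA⟩
  obtain ⟨D, hdom, hconn, hcard⟩ := Nat.sInf_mem (s := {k | ∃ D : Finset (A : Set V),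
    IsDominating (G.induce (A : Set V)) D ∧
      ((G.induce (A : Set V)).induce (D : Set (A : Set V))).Connected ∧ D.card = k})
    ⟨_, hself.exists_induce⟩
  refine ⟨D.map ⟨Subtype.val, Subtype.val_injective⟩, ⟨?_, ?_, ?_⟩, ?_⟩
  · intro x hx
    obtain ⟨y, -, rfl⟩ := Finset.mem_map.1 hx
    exact y.2
  · intro u hu hun
    obtain ⟨x, hx, hxu⟩ := hdom ⟨u, hu⟩ (fun h => hun (Finset.mem_map.2 ⟨_, h, rfl⟩))
    exact ⟨x.1, Finset.mem_map.2 ⟨_, hx, rfl⟩, hxu⟩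
  · rw [connected_induce_induce_iff] at hconn
    convert hconn using 2
    all_goals simp
  · rw [Finset.card_map, hcard]
    simp [partWeight, hn, connDomNum]

lemma two_le_partWeight {A : Finset V} (hA : (G.induce (A : Set V)).Connected)
    (hn : ¬ G.IsClique (A : Set V)) : 2 ≤ partWeight G A := by
  obtain ⟨C, hC, hw⟩ := exists_isConnDomOn_of_connected hA hn
  obtain ⟨x⟩ := hC.connected.nonempty
  have : 0 < C.card := Finset.card_pos.2 ⟨x.1, x.2⟩
  omega

lemma connected_singleton (v : V) : (G.induce (({v} : Finset V) : Set V)).Connected := by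
  rw [Finset.coe_singleton]
  have : Nonempty ({v} : Set V) := ⟨⟨v, rfl⟩⟩
  exact ⟨.of_subsingleton⟩

variable [DecidableEq V]

lemma connected_pair {u v : V} (h : G.Adj u v) :
    (G.induce (({u, v} : Finset V) : Set V)).Connected := by
  rw [Finset.coe_pair]
  exact SimpleGraph.induce_pair_connected_of_adj h

lemma connected_union {A B : Finset V} (hA : (G.induce (A : Set V)).Connected)
    (hB : (G.induce (B : Set V)).Connected) (h : (A ∩ B).Nonempty) :
    (G.induce ((A ∪ B : Finset V) : Set V)).Connected := by
  rw [Finset.coe_union]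
  exact SimpleGraph.induce_union_connected hA.preconnected hB.preconnected (by exact_mod_cast h)

lemma connected_insert {A : Finset V} (hA : (G.induce (A : Set V)).Connected) {u v : V}
    (hu : u ∈ A) (h : G.Adj v u) : (G.induce ((insert v A : Finset V) : Set V)).Connected := by
  have : insert v A = {v, u} ∪ A := by grind
  rw [this]
  exact connected_union (connected_pair h) hA ⟨u, by simp [hu]⟩

lemma connected_union_of_adj {A L : Finset V} (hA : (G.induce (A : Set V)).Connected) {v : V}
    (hv : v ∈ A) (h : ∀ w ∈ L, G.Adj v w) :
    (G.induce ((A ∪ L : Finset V) : Set V)).Connected := by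
  induction L using Finset.induction_on with
  | empty => rwa [Finset.union_empty]
  | insert w L hw ih =>
    rw [Finset.union_insert]
    exact connected_insert (ih fun x hx => h x (by grind)) (Finset.mem_union_left _ hv)
      (h w (by grind)).symm

/-- Adding `v` to a connected dominating set keeps it connected and dominates all of `L` at once.
For a clique, `{v}` alone suffices and the weight becomes at most 2. -/
lemma partWeight_union_le {A L : Finset V} (hA : (G.induce (A : Set V)).Connected) {v : V}
    (hv : v ∈ A) (h : ∀ w ∈ L, G.Adj v w) : partWeight G (A ∪ L) ≤ partWeight G A + 1 := by
  by_cases hcl : G.IsClique (A : Set V)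
  · rw [partWeight_of_isClique hcl]
    refine partWeight_le_of_isConnDomOn (C := {v}) ⟨by grind, ?_, connected_singleton v⟩
    intro u hu hun
    refine ⟨v, by simp, ?_⟩
    rcases Finset.mem_union.1 hu with hu | hu
    · exact hcl hv hu (by grind)
    · exact h u hu
  · obtain ⟨C, hC, hw⟩ := exists_isConnDomOn_of_connected hA hcl
    have hins : (G.induce ((insert v C : Finset V) : Set V)).Connected := by
      by_cases hvC : v ∈ C
      · rw [Finset.insert_eq_of_mem hvC]
        exact hC.connected
      · obtain ⟨x, hx, hxv⟩ := hC.dominates v hv hvC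
        exact connected_insert hC.connected hx hxv.symm
    have hle := partWeight_le_of_isConnDomOn (A := A ∪ L) (C := insert v C) ⟨?_, ?_, hins⟩
    · have := Finset.card_insert_le v C
      omega
    · have := hC.subset
      grind
    · intro u hu hun
      rcases Finset.mem_union.1 hu with hu | hu
      · obtain ⟨x, hx, hxu⟩ := hC.dominates u hu (by grind)
        exact ⟨x, by grind, hxu⟩
      · exact ⟨v, by grind, h u hu⟩

end Weight

end EternalDomination

namespace EternalDomination

/-! ### The two peeling configurations -/

section Reduction

variable {V : Type*} [DecidableEq V] {G : SimpleGraph V}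

/-- In the subgraph induced by `S`, the vertex `v` is adjacent to all vertices of `L`, these are
leaves, and `v` has at most one further neighbour. -/
structure IsMultiStem (G : SimpleGraph V) (S L : Finset V) (v u : V) : Prop where
  mem : v ∈ S
  subset : L ⊆ S
  notMem : v ∉ L
  two_le : 2 ≤ L.card
  adj : ∀ w ∈ L, G.Adj v w
  leaf : ∀ w ∈ L, ∀ x ∈ S, G.Adj w x → x = v
  other : ∀ w ∈ S, G.Adj v w → w ∈ L ∨ w = u

/-- In the subgraph induced by `S`, the vertex `v` has exactly the two neighbours `l` and `u`, and
`l` is a leaf. -/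
structure IsSimpleStem (G : SimpleGraph V) (S : Finset V) (v l u : V) : Prop where
  mem : v ∈ S
  mem_leaf : l ∈ S
  mem_other : u ∈ S
  ne : l ≠ u
  adj_leaf : G.Adj v l
  adj_other : G.Adj v u
  leaf : ∀ x ∈ S, G.Adj l x → x = v
  other : ∀ w ∈ S, G.Adj v w → w = l ∨ w = u

lemma IsMultiStem.connected {S L : Finset V} {v u : V} (h : IsMultiStem G S L v u)
    (hS : (G.induce (S : Set V)).Connected) :
    (G.induce ((S \ L : Finset V) : Set V)).Connected := by
  refine connected_sdiff_of_leaves hS ?_ ⟨v, by simp [h.mem, h.notMem]⟩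
  intro w hw x hx y hy hwx hwy
  rw [h.leaf w hw x hx hwx, h.leaf w hw y hy hwy]

lemma IsMultiStem.connected_erase {S L : Finset V} {v u : V} (h : IsMultiStem G S L v u)
    (hS : (G.induce (S : Set V)).Connected) (hne : ((S \ L).erase v).Nonempty) :
    (G.induce (((S \ L).erase v : Finset V) : Set V)).Connected := by
  rw [Finset.erase_eq] at hne ⊢
  refine connected_sdiff_of_leaves (h.connected hS) ?_ hne
  intro w hw x hx y hy hwx hwy
  obtain rfl := Finset.mem_singleton.1 hw
  rw [Finset.mem_sdiff] at hx hy
  rw [(h.other x hx.1 hwx).resolve_left hx.2, (h.other y hy.1 hwy).resolve_left hy.2]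

lemma IsSimpleStem.connected {S : Finset V} {v l u : V} (h : IsSimpleStem G S v l u)
    (hS : (G.induce (S : Set V)).Connected) :
    (G.induce ((S \ {v, l} : Finset V) : Set V)).Connected := by
  have hvl := h.adj_leaf.ne
  have hvu := h.adj_other.ne
  have h1 : (G.induce ((S \ {l} : Finset V) : Set V)).Connected := by
    refine connected_sdiff_of_leaves hS ?_ ⟨v, by simp [h.mem, hvl]⟩
    intro w hw x hx y hy hwx hwy
    obtain rfl := Finset.mem_singleton.1 hw
    rw [h.leaf x hx hwx, h.leaf y hy hwy]
  have h2 : S \ {v, l} = (S \ {l}) \ {v} := by grind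
  rw [h2]
  refine connected_sdiff_of_leaves h1 ?_ ⟨u, by simp [h.mem_other, hvu.symm, h.ne.symm]⟩
  intro w hw x hx y hy hwx hwy
  obtain rfl := Finset.mem_singleton.1 hw
  simp only [Finset.mem_sdiff, Finset.mem_singleton] at hx hy
  rw [(h.other x hx.1 hwx).resolve_left hx.2, (h.other y hy.1 hwy).resolve_left hy.2]

lemma exists_isMultiStem_or_isSimpleStem (hG : G.IsAcyclic) {S : Finset V}
    (hS : (G.induce (S : Set V)).Connected) (hc : 3 ≤ S.card) :
    (∃ L v u, IsMultiStem G S L v u) ∨ ∃ v l u, IsSimpleStem G S v l u := by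
  classical
  obtain ⟨v, hv, u, l, hl, hlu, hvl, hall⟩ := exists_stem hG hS (by omega)
  have hleaf : ∀ w ∈ S, G.Adj v w → w ≠ u → ∀ x ∈ S, G.Adj w x → x = v :=
    fun w hw hvw hwu => (hall w hw hvw).resolve_left hwu
  set L : Finset V := {w ∈ S | G.Adj v w ∧ w ≠ u} with hL
  have hlL : l ∈ L := by simp [hL, hl, hvl, hlu]
  by_cases h2 : 2 ≤ L.card
  · left
    refine ⟨L, v, u, hv, Finset.filter_subset _ _, by simp [hL], h2, ?_, ?_, ?_⟩
    · intro w hw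
      exact (Finset.mem_filter.1 hw).2.1
    · intro w hw
      obtain ⟨h1, h2, h3⟩ := Finset.mem_filter.1 hw
      exact hleaf w h1 h2 h3
    · intro w hw hvw
      by_cases hwu : w = u
      · exact Or.inr hwu
      · exact Or.inl (Finset.mem_filter.2 ⟨hw, hvw, hwu⟩)
  · right
    have hL1 : ∀ w ∈ L, w = l := fun w hw =>
      Finset.card_le_one.1 (by omega) w hw l hlL
    have hother : ∀ w ∈ S, G.Adj v w → w = l ∨ w = u := by
      intro w hw hvw
      by_cases hwu : w = u
      · exact Or.inr hwu
      · exact Or.inl (hL1 w (Finset.mem_filter.2 ⟨hw, hvw, hwu⟩))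
    have hconn : (G.induce ((S \ {l} : Finset V) : Set V)).Connected := by
      refine connected_sdiff_of_leaves hS ?_ ⟨v, by simp [hv, hvl.ne]⟩
      intro w hw x hx y hy hwx hwy
      obtain rfl := Finset.mem_singleton.1 hw
      rw [hleaf _ hl hvl hlu x hx hwx, hleaf _ hl hvl hlu y hy hwy]
    have hcard : (S \ {l}).card = S.card - 1 := by
      rw [← Finset.erase_eq, Finset.card_erase_of_mem hl]
    obtain ⟨x, hx, hvx⟩ := exists_adj_of_connected hconn (by omega) (w := v)
      (by simp [hv, hvl.ne])
    simp only [Finset.mem_sdiff, Finset.mem_singleton] at hx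
    obtain rfl : x = u := (hother x hx.1 hvx).resolve_left hx.2
    exact ⟨v, l, x, hv, hl, hx.1, hlu, hvl, hvx, hleaf l hl hvl hlu, hother⟩

end Reduction

/-! ### Extending colonizations over a peeled piece -/

section Colonization

variable {V : Type*} [DecidableEq V] {G : SimpleGraph V}

/-- The vertices in `S` have a partition into connected parts of total weight at most `k`. -/
def HasColonization (G : SimpleGraph V) (S : Finset V) (k : ℕ) : Prop :=
  ∃ P : Finpartition S, (∀ A ∈ P.parts, (G.induce (A : Set V)).Connected) ∧
    ∑ A ∈ P.parts, partWeight G A ≤ k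

lemma exists_finpartition_insert {S A S' : Finset V} (P : Finpartition S) (hA : A.Nonempty)
    (hd : Disjoint S A) (hS' : S ∪ A = S') :
    A ∉ P.parts ∧ ∃ P' : Finpartition S', P'.parts = insert A P.parts := by
  refine ⟨fun h => ?_, P.extend hA.ne_empty hd hS', rfl⟩
  exact hA.ne_empty (Finset.disjoint_self_iff_empty A |>.1 (hd.mono_left (P.le h)))

lemma exists_finpartition_erase {S A : Finset V} (P : Finpartition S) (hA : A ∈ P.parts) :
    ∃ P' : Finpartition (S \ A), P'.parts = P.parts.erase A := by
  refine ⟨P.ofSubset (parts := P.parts.erase A) (Finset.erase_subset _ _) ?_, rfl⟩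
  ext x
  simp only [Finset.mem_sup, Finset.mem_erase, id, Finset.mem_sdiff]
  constructor
  · rintro ⟨B, ⟨hBA, hB⟩, hx⟩
    exact ⟨P.le hB hx, fun hxA => Finset.disjoint_left.1 (P.disjoint hB hA hBA) hx hxA⟩
  · rintro ⟨hxS, hxA⟩
    obtain ⟨B, hB, hx⟩ := P.exists_mem hxS
    exact ⟨B, ⟨fun h => hxA (h ▸ hx), hB⟩, hx⟩

lemma HasColonization.mono {S : Finset V} {k m : ℕ} (h : HasColonization G S k) (hkm : k ≤ m) :
    HasColonization G S m :=
  let ⟨P, hP, hw⟩ := h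
  ⟨P, hP, hw.trans hkm⟩

lemma HasColonization.union {S A S' : Finset V} {k : ℕ} (h : HasColonization G S k)
    (hA : (G.induce (A : Set V)).Connected) (hd : Disjoint S A) (hS' : S ∪ A = S') :
    HasColonization G S' (k + partWeight G A) := by
  obtain ⟨P, hP, hw⟩ := h
  obtain ⟨x⟩ := hA.nonempty
  obtain ⟨hn, P', hP'⟩ := exists_finpartition_insert P ⟨x.1, x.2⟩ hd hS'
  refine ⟨P', ?_, ?_⟩
  · rw [hP']
    intro B hB
    rcases Finset.mem_insert.1 hB with rfl | hB
    · exact hA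
    · exact hP B hB
  · rw [hP', Finset.sum_insert hn]
    omega

/-- The part containing `v` absorbs `L`, at a cost of at most 1 by `partWeight_union_le`. -/
lemma HasColonization.union_of_adj {S L S' : Finset V} {k : ℕ} {v : V} (h : HasColonization G S k)
    (hv : v ∈ S) (hd : Disjoint S L) (hadj : ∀ w ∈ L, G.Adj v w) (hS' : S ∪ L = S') :
    HasColonization G S' (k + 1) := by
  obtain ⟨P, hP, hw⟩ := h
  obtain ⟨A, hA, hvA⟩ := P.exists_mem hv
  obtain ⟨P', hP'⟩ := exists_finpartition_erase P hA
  have hc : HasColonization G (S \ A) (∑ B ∈ P.parts.erase A, partWeight G B) := by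
    refine ⟨P', ?_, by rw [hP']⟩
    rw [hP']
    exact fun B hB => hP B (Finset.mem_of_mem_erase hB)
  have hAS : A ⊆ S := P.le hA
  have := hc.union (A := A ∪ L) (S' := S') (connected_union_of_adj (hP A hA) hvA hadj)
    (by
      rw [Finset.disjoint_left] at hd ⊢
      intro x hx hx'
      have := @hd x
      grind) (by grind)
  refine this.mono ?_
  have h1 := partWeight_union_le (hP A hA) hvA hadj
  have h2 := Finset.sum_erase_add P.parts (partWeight G) hA
  omega

lemma hasColonization_one {S : Finset V} (hS : (G.induce (S : Set V)).Connected)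
    (hcl : G.IsClique (S : Set V)) : HasColonization G S 1 := by
  have h0 : HasColonization G (∅ : Finset V) 0 :=
    ⟨Finpartition.empty _, by simp, by simp⟩
  have := h0.union hS (Finset.disjoint_empty_left S) (Finset.empty_union S)
  rwa [partWeight_of_isClique hcl] at this

lemma isClique_of_connected_of_card_le_two {S : Finset V} (hS : (G.induce (S : Set V)).Connected)
    (hc : S.card ≤ 2) : G.IsClique (S : Set V) := by
  intro a ha b hb hab
  have hS2 : ({a, b} : Finset V) = S :=
    Finset.eq_of_subset_of_card_le (by grind) (by rw [Finset.card_pair hab]; omega)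
  obtain ⟨x, hx, hax⟩ := exists_adj_of_connected hS
    (by rw [← hS2, Finset.card_pair hab]) ha
  have : x = b := by
    have := hax.ne
    grind
  exact this ▸ hax

lemma IsMultiStem.hasColonization {S L : Finset V} {v u : V} (h : IsMultiStem G S L v u) {k : ℕ}
    (hk : HasColonization G (S \ L) k) : HasColonization G S (k + 1) :=
  hk.union_of_adj (v := v) (L := L) (by simp [h.mem, h.notMem]) Finset.sdiff_disjoint h.adj
    (Finset.sdiff_union_of_subset h.subset)

lemma IsSimpleStem.hasColonization {S : Finset V} {v l u : V} (h : IsSimpleStem G S v l u) {k : ℕ}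
    (hk : HasColonization G (S \ {v, l}) k) : HasColonization G S (k + 1) := by
  have hp := connected_pair h.adj_leaf
  have := hk.union hp Finset.sdiff_disjoint (Finset.sdiff_union_of_subset
    (by have := h.mem; have := h.mem_leaf; grind))
  rwa [partWeight_of_isClique (isClique_of_connected_of_card_le_two hp
    (Finset.card_le_two))] at this

end Colonization

/-! ### Lower bound: removing one guard per peeling step -/

section RelaxedGame

variable {V : Type*} {G : SimpleGraph V}

/-- A guard on `x` can be on `y` in the next round. -/
def Step (G : SimpleGraph V) (x y : V) : Prop := x = y ∨ G.Adj x y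

lemma Step.symm {x y : V} (h : Step G x y) : Step G y x :=
  h.elim (fun h => Or.inl h.symm) fun h => Or.inr h.symm

/-- On the subgraph induced by `S`, with several guards allowed on a vertex, every attack can be
answered within a family of configurations of `k` guards. -/
def Defendable (G : SimpleGraph V) (S : Finset V) (k : ℕ) : Prop :=
  ∃ F : Set (Multiset V), F.Nonempty ∧ ∀ D ∈ F, D.card = k ∧ (∀ x ∈ D, x ∈ S) ∧
    ∀ r ∈ S, r ∉ D → ∃ D' ∈ F, Multiset.Rel (Step G) D D' ∧ r ∈ D'

/-- One guard is dropped before the move (at `z`) and one after it (at `w`). If they are different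
guards, one going `x → w` and the other `z → y`, the pair is replaced by a single guard `ρ x → ρ y`.
-/
lemma rel_map_of_rel_cons {R : V → V → Prop} {ρ : V → V} {z w : V} {A B : Multiset V}
    (h : Multiset.Rel R (z ::ₘ A) (w ::ₘ B))
    (hstep : ∀ x ∈ A, ∀ y ∈ B, R x y → R (ρ x) (ρ y))
    (hnear : ∀ x ∈ A, ∀ y ∈ B, R x w → R z y → R (ρ x) (ρ y)) :
    Multiset.Rel R (A.map ρ) (B.map ρ) := by
  rw [Multiset.rel_map]
  obtain ⟨y, B', hzy, hAB', heq⟩ := Multiset.rel_cons_left.1 h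
  rcases Multiset.cons_eq_cons.1 heq with ⟨rfl, rfl⟩ | ⟨-, C, rfl, rfl⟩
  · exact hAB'.mono hstep
  · obtain ⟨x, A', hxw, hA'C, rfl⟩ := Multiset.rel_cons_right.1 hAB'
    refine Multiset.Rel.cons (hnear x (by simp) y (by simp) hxw hzy) (hA'C.mono ?_)
    intro a ha b hb hab
    exact hstep a (by simp [ha]) b (by simp [hb]) hab

/-- The leaf in `hleaf` forces a guard in the core `C` at all times. Drop one such guard and push
the others into `S'` by the retraction `ρ`. `hnear` covers a change of the dropped guard. `hcore`
covers attacks on a core vertex that survives in `S'`. -/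
lemma Defendable.reduce [DecidableEq V] {S S' C : Finset V} {k : ℕ} (h : Defendable G S k)
    (ρ : V → V) (hmem : ∀ x ∈ S, ρ x ∈ S') (hsub : S' ⊆ S)
    (hstep : ∀ x ∈ S, ∀ y ∈ S, Step G x y → Step G (ρ x) (ρ y))
    (hnear : ∀ x ∈ S, ∀ y ∈ S, ∀ z ∈ C, ∀ w ∈ C, Step G x w → Step G z y → Step G (ρ x) (ρ y))
    (hid : ∀ x ∈ S', x ∉ C → ρ x = x)
    (hleaf : ∃ l ∈ S, ∀ x ∈ S, Step G x l → x ∈ C)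
    (hcore : ∀ r ∈ S', r ∈ C → (∀ c ∈ C, ρ c = r) ∧ ∃ a ∈ C, ∃ b ∈ C, a ∈ S ∧ b ∈ S ∧ a ≠ b ∧
      (∀ x ∈ S, Step G x a → x ∈ C ∧ x ≠ b) ∧ ∀ x ∈ S, Step G x b → x ∈ C ∧ x ≠ a) :
    ∃ m, k = m + 1 ∧ Defendable G S' m := by
  obtain ⟨F, ⟨D₀, hD₀⟩, hF⟩ := h
  have hdom : ∀ D ∈ F, ∀ r ∈ S, ∃ x ∈ D, Step G x r := by
    intro D hD r hr
    by_cases hrD : r ∈ D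
    · exact ⟨r, hrD, Or.inl rfl⟩
    · obtain ⟨D', -, hrel, hr'⟩ := (hF D hD).2.2 r hr hrD
      obtain ⟨x, hx, hxr⟩ := Multiset.exists_mem_of_rel_of_mem (Multiset.rel_flip.2 hrel) hr'
      exact ⟨x, hx, hxr⟩
  have hmeet : ∀ D ∈ F, ∃ z ∈ C, ∃ A, D = z ::ₘ A := by
    intro D hD
    obtain ⟨l, hl, hlC⟩ := hleaf
    obtain ⟨x, hx, hxl⟩ := hdom D hD l hl
    obtain ⟨A, hA⟩ := Multiset.exists_cons_of_mem hx
    exact ⟨x, hlC x ((hF D hD).2.1 x hx) hxl, A, hA⟩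
  obtain ⟨z₀, hz₀, A₀, hA₀⟩ := hmeet D₀ hD₀
  refine ⟨A₀.card, by rw [← (hF D₀ hD₀).1, hA₀, Multiset.card_cons],
    {E | ∃ D ∈ F, ∃ z ∈ C, ∃ A, D = z ::ₘ A ∧ E = A.map ρ},
    ⟨_, D₀, hD₀, z₀, hz₀, A₀, hA₀, rfl⟩, ?_⟩
  rintro _ ⟨D, hD, z, hz, A, rfl, rfl⟩
  have hDS := (hF _ hD).2.1
  refine ⟨?_, ?_, ?_⟩
  · have h1 := (hF _ hD).1
    have h2 := (hF _ hD₀).1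
    rw [hA₀] at h2
    rw [Multiset.card_cons] at h1 h2
    rw [Multiset.card_map]
    omega
  · intro x hx
    obtain ⟨y, hy, rfl⟩ := Multiset.mem_map.1 hx
    exact hmem y (hDS y (Multiset.mem_cons_of_mem hy))
  · intro r hr hrA
    have key : ∀ w ∈ C, ∀ B, (w ::ₘ B) ∈ F → Multiset.Rel (Step G) (z ::ₘ A) (w ::ₘ B) →
        Multiset.Rel (Step G) (A.map ρ) (B.map ρ) := by
      intro w hw B hB hrel
      have hBS := (hF _ hB).2.1
      refine rel_map_of_rel_cons hrel ?_ ?_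
      · intro x hx y hy
        exact hstep x (hDS x (Multiset.mem_cons_of_mem hx)) y (hBS y (Multiset.mem_cons_of_mem hy))
      · intro x hx y hy
        exact hnear x (hDS x (Multiset.mem_cons_of_mem hx)) y (hBS y (Multiset.mem_cons_of_mem hy))
          z hz w hw
    by_cases hrC : r ∈ C
    · obtain ⟨hconst, a, haC, b, hbC, haS, hbS, hab, hNa, hNb⟩ := hcore r hr hrC
      have hnoC : ∀ x ∈ A, x ∉ C := fun x hx hxC =>
        hrA (Multiset.mem_map.2 ⟨x, hx, hconst x hxC⟩)
      -- An attack on `r` is simulated by an attack on the empty leaf-like vertex `a`. The answer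
      -- has a guard on `a`, which is dropped, and a different guard in `C` covering `b`, which `ρ`
      -- sends to `r`.
      have main : ∀ a ∈ C, ∀ b, a ∈ S → b ∈ S → (∀ x ∈ S, Step G x b → x ∈ C ∧ x ≠ a) → a ≠ z →
          ∃ D' ∈ {E | ∃ D ∈ F, ∃ z ∈ C, ∃ A, D = z ::ₘ A ∧ E = A.map ρ},
            Multiset.Rel (Step G) (A.map ρ) D' ∧ r ∈ D' := by
        intro a haC b haS hbS hNb haz
        have haD : a ∉ z ::ₘ A := by
          rw [Multiset.mem_cons]
          rintro (h | h)
          · exact haz h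
          · exact hnoC a h haC
        obtain ⟨D', hD', hrel, haD'⟩ := (hF _ hD).2.2 a haS haD
        obtain ⟨B, rfl⟩ := Multiset.exists_cons_of_mem haD'
        obtain ⟨x, hx, hxb⟩ := hdom _ hD' b hbS
        obtain ⟨hxC, hxa⟩ := hNb x ((hF _ hD').2.1 x hx) hxb
        exact ⟨_, ⟨_, hD', a, haC, B, rfl, rfl⟩, key a haC B hD' hrel,
          Multiset.mem_map.2 ⟨x, (Multiset.mem_cons.1 hx).resolve_left hxa, hconst x hxC⟩⟩
      -- The only guard in the core stands on `z`, so at least one of `a`, `b` is free to be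
      -- attacked.
      by_cases haz : a = z
      · exact main b hbC a hbS haS hNa (haz ▸ hab.symm)
      · exact main a haC b haS hbS hNb haz
    · have hrD : r ∉ z ::ₘ A := by
        rw [Multiset.mem_cons]
        rintro (h | h)
        · exact hrC (h ▸ hz)
        · exact hrA (Multiset.mem_map.2 ⟨r, h, hid r hr hrC⟩)
      obtain ⟨D', hD', hrel, hrD'⟩ := (hF _ hD).2.2 r (hsub hr) hrD
      obtain ⟨w, hw, B, rfl⟩ := hmeet D' hD'
      refine ⟨_, ⟨_, hD', w, hw, B, rfl, rfl⟩, key w hw B hD' hrel, ?_⟩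
      exact Multiset.mem_map.2 ⟨r, (Multiset.mem_cons.1 hrD').resolve_left
        (fun h => hrC (h ▸ hw)), hid r hr hrC⟩

variable [DecidableEq V]

/-- Fold the leaves onto `v`. The core is `v` with its leaves, and two of the leaves serve as the
attack vertices for `hcore`. -/
lemma IsMultiStem.defendable {S L : Finset V} {v u : V} (h : IsMultiStem G S L v u) {k : ℕ}
    (hk : Defendable G S k) : ∃ m, k = m + 1 ∧ Defendable G (S \ L) m := by
  have hv := h.mem
  have hvL := h.notMem
  have hLS := h.subset
  have hleaf : ∀ w ∈ L, ∀ x ∈ S, Step G x w → x = v ∨ x = w := by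
    rintro w hw x hx (rfl | hxw)
    · exact Or.inr rfl
    · exact Or.inl (h.leaf w hw x hx hxw.symm)
  have hnbr : ∀ x ∈ S, ∀ w ∈ insert v L, Step G x w → x ∈ L ∨ x = v ∨ x = u ∧ G.Adj v u := by
    intro x hx w hw hxw
    rcases Finset.mem_insert.1 hw with rfl | hw
    · rcases hxw with rfl | hxw
      · exact Or.inr (Or.inl rfl)
      · rcases h.other x hx hxw.symm with hxL | rfl
        · exact Or.inl hxL
        · exact Or.inr (Or.inr ⟨rfl, hxw.symm⟩)
    · rcases hleaf w hw x hx hxw with rfl | rfl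
      · exact Or.inr (Or.inl rfl)
      · exact Or.inl hw
  obtain ⟨a, ha, b, hb, hab⟩ := Finset.one_lt_card.1 h.two_le
  refine hk.reduce (C := insert v L) (fun x => if x ∈ L then v else x) ?_ Finset.sdiff_subset
    ?_ ?_ ?_ ⟨a, hLS ha, ?_⟩ ?_
  · intro x hx
    grind
  · rintro x hx y hy (rfl | hxy)
    · exact Or.inl rfl
    · split_ifs with h1 h2 h2
      · exact Or.inl rfl
      · exact Or.inl (h.leaf x h1 y hy hxy).symm
      · exact Or.inl (h.leaf y h2 x hx hxy.symm)
      · exact Or.inr hxy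
  · intro x hx y hy z hz w hw hxw hzy
    have hρ : ∀ x, (x ∈ L ∨ x = v ∨ x = u ∧ G.Adj v u) →
        (if x ∈ L then v else x) = v ∨ (if x ∈ L then v else x) = u ∧ G.Adj v u := by
      intro x hx
      grind
    rcases hρ x (hnbr x hx w hw hxw) with h1 | ⟨h1, h1'⟩ <;>
      rcases hρ y (hnbr y hy z hz hzy.symm) with h2 | ⟨h2, h2'⟩ <;> rw [h1, h2]
    · exact Or.inl rfl
    · exact Or.inr h2'
    · exact Or.inr h1'.symm
    · exact Or.inl rfl
  · intro x hx hxC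
    grind
  · intro x hx hxa
    rcases hleaf a ha x hx hxa with rfl | rfl <;> simp [ha]
  · intro r hr hrC
    have hrv : r = v := by grind
    subst hrv
    refine ⟨by grind, a, by grind, b, by grind, hLS ha, hLS hb, hab, ?_, ?_⟩
    · intro x hx hxa
      have := hleaf a ha x hx hxa
      grind
    · intro x hx hxb
      have := hleaf b hb x hx hxb
      grind

/-- Fold `v` and `l` onto `u`, the only outside vertex adjacent to the core. No core vertex
survives, so `hcore` is vacuous. -/
lemma IsSimpleStem.defendable {S : Finset V} {v l u : V} (h : IsSimpleStem G S v l u) {k : ℕ}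
    (hk : Defendable G S k) : ∃ m, k = m + 1 ∧ Defendable G (S \ {v, l}) m := by
  have hv := h.mem
  have hl := h.mem_leaf
  have hu := h.mem_other
  have hvu := h.adj_other.ne
  have hlu := h.ne
  have hnbr : ∀ x ∈ S, ∀ w ∈ ({v, l} : Finset V), Step G x w →
      x ∈ ({v, l} : Finset V) ∨ x = u := by
    intro x hx w hw hxw
    rcases hxw with rfl | hxw
    · exact Or.inl hw
    · rcases Finset.mem_insert.1 hw with rfl | hw
      · rcases h.other x hx hxw.symm with rfl | rfl <;> simp
      · obtain rfl := Finset.mem_singleton.1 hw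
        rw [h.leaf x hx hxw.symm]
        simp
  refine hk.reduce (C := {v, l}) (fun x => if x ∈ ({v, l} : Finset V) then u else x) ?_
    Finset.sdiff_subset ?_ ?_ ?_ ⟨l, hl, ?_⟩ ?_
  · intro x hx
    grind
  · intro x hx y hy hxy
    split_ifs with h1 h2 h2
    · exact Or.inl rfl
    · exact Or.inl ((hnbr y hy x h1 hxy.symm).resolve_left h2).symm
    · exact Or.inl ((hnbr x hx y h2 hxy).resolve_left h1)
    · exact hxy
  · intro x hx y hy z hz w hw hxw hzy
    left
    have h1 := hnbr x hx w hw hxw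
    have h2 := hnbr y hy z hz hzy.symm
    grind
  · intro x hx hxC
    grind
  · rintro x hx (rfl | hxl)
    · simp
    · rw [h.leaf x hx hxl.symm]
      simp
  · intro r hr hrC
    grind

theorem Defendable.hasColonization (hG : G.IsAcyclic) {S : Finset V}
    (hS : (G.induce (S : Set V)).Connected) {k : ℕ} (hk : Defendable G S k) :
    HasColonization G S k := by
  induction h : S.card using Nat.strong_induction_on generalizing S k with
  | _ n ih =>
  subst h
  rcases le_or_gt S.card 2 with h2 | h3
  · refine (hasColonization_one hS (isClique_of_connected_of_card_le_two hS h2)).mono ?_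
    obtain ⟨F, ⟨D, hD⟩, hF⟩ := hk
    obtain ⟨r⟩ := hS.nonempty
    obtain ⟨hcard, -, hresp⟩ := hF D hD
    by_contra! hk0
    obtain rfl : k = 0 := by omega
    obtain rfl := Multiset.card_eq_zero.1 hcard
    obtain ⟨D', -, hrel, hr⟩ := hresp r.1 r.2 (Multiset.notMem_zero _)
    rw [Multiset.rel_zero_left.1 hrel] at hr
    exact Multiset.notMem_zero _ hr
  · rcases exists_isMultiStem_or_isSimpleStem hG hS h3 with ⟨L, v, u, hst⟩ | ⟨v, l, u, hst⟩
    · obtain ⟨m, rfl, hm⟩ := hst.defendable hk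
      refine hst.hasColonization (ih _ ?_ (hst.connected hS) hm rfl)
      refine Finset.card_lt_card (Finset.sdiff_ssubset hst.subset (Finset.card_pos.1 ?_))
      have := hst.two_le
      omega
    · obtain ⟨m, rfl, hm⟩ := hst.defendable hk
      refine hst.hasColonization (ih _ ?_ (hst.connected hS) hm rfl)
      refine Finset.card_lt_card (Finset.sdiff_ssubset ?_ (by simp))
      have := hst.mem
      have := hst.mem_leaf
      grind

end RelaxedGame

end EternalDomination

namespace EternalDomination

/-! ### Upper bound: strategies from colonizations, and passage to the actual game -/

section Strategy

variable {V : Type*} {G : SimpleGraph V}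

/-- On the subgraph induced by `S`, every attack can be answered within a family of configurations
of `k` guards, no two of them on the same vertex. -/
def Guardable (G : SimpleGraph V) (S : Finset V) (k : ℕ) : Prop :=
  ∃ F : Set (Finset V), F.Nonempty ∧ ∀ D ∈ F, D.card = k ∧ D ⊆ S ∧
    ∀ r ∈ S, r ∉ D → ∃ D' ∈ F, Multiset.Rel (Step G) D.val D'.val ∧ r ∈ D'

lemma rel_step_refl (D : Multiset V) : Multiset.Rel (Step G) D D :=
  Multiset.rel_refl_of_refl_on fun _ _ => Or.inl rfl

lemma guardable_of_isClique {S : Finset V} (hne : S.Nonempty) (hcl : G.IsClique (S : Set V)) :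
    Guardable G S 1 := by
  obtain ⟨x₀, hx₀⟩ := hne
  refine ⟨{D | ∃ x ∈ S, D = {x}}, ⟨_, x₀, hx₀, rfl⟩, ?_⟩
  rintro _ ⟨x, hx, rfl⟩
  refine ⟨Finset.card_singleton x, Finset.singleton_subset_iff.2 hx, fun r hr hrx => ?_⟩
  rw [Finset.mem_singleton] at hrx
  exact ⟨{r}, ⟨r, hr, rfl⟩,
    Multiset.Rel.cons (show Step G x r from Or.inr (hcl hx hr (Ne.symm hrx))) Multiset.Rel.zero,
    Finset.mem_singleton_self r⟩

/-- Each guard moves one place along the walk: `x` enters at the start and the last guard leaves for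
`r`, so the occupied walk stays occupied. -/
lemma rel_step_support {y y' : V} (q : G.Walk y y') {x r : V} (hx : G.Adj x y) (hr : G.Adj y' r) :
    Multiset.Rel (Step G) (x ::ₘ (q.support : Multiset V)) (r ::ₘ (q.support : Multiset V)) := by
  induction q generalizing x with
  | nil =>
    rw [SimpleGraph.Walk.support_nil, ← Multiset.cons_coe, Multiset.cons_swap r]
    exact Multiset.Rel.cons (Or.inr hx) (Multiset.Rel.cons (Or.inr hr) (rel_step_refl _))
  | cons h q ih =>
    rw [SimpleGraph.Walk.support_cons, ← Multiset.cons_coe, Multiset.cons_swap r]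
    exact Multiset.Rel.cons (Or.inr hx) (ih h hr)

/-- Configurations are `C` plus one roaming guard. To reach `r`, shift along a path inside `C` from
a neighbour of the roaming guard to a neighbour of `r`. A path is needed so that its support is a
submultiset of `C`. -/
lemma IsConnDomOn.exists_guardable [DecidableEq V] {A C : Finset V} (h : IsConnDomOn G A C) :
    ∃ k ≤ 1 + C.card, Guardable G A k := by
  by_cases hAC : A ⊆ C
  · refine ⟨C.card, by omega, {C}, ⟨C, rfl⟩, ?_⟩
    rintro _ rfl
    exact ⟨rfl, h.subset, fun r hr hrC => absurd (hAC hr) hrC⟩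
  · obtain ⟨x₀, hx₀, hx₀C⟩ := Finset.not_subset.1 hAC
    refine ⟨1 + C.card, le_rfl, {D | ∃ x ∈ A, x ∉ C ∧ D = insert x C},
      ⟨_, x₀, hx₀, hx₀C, rfl⟩, ?_⟩
    rintro _ ⟨x, hx, hxC, rfl⟩
    refine ⟨by rw [Finset.card_insert_of_notMem hxC, add_comm],
      Finset.insert_subset hx h.subset, fun r hr hrx => ?_⟩
    have hrC : r ∉ C := fun h => hrx (Finset.mem_insert_of_mem h)
    refine ⟨_, ⟨r, hr, hrC, rfl⟩, ?_, Finset.mem_insert_self r C⟩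
    obtain ⟨y, hy, hyx⟩ := h.dominates x hx hxC
    obtain ⟨y', hy', hyr⟩ := h.dominates r hr hrC
    obtain ⟨q, hq⟩ := h.connected.exists_isPath ⟨y, hy⟩ ⟨y', hy'⟩
    have hnodup : (q.support.map Subtype.val).Nodup :=
      hq.support_nodup.map Subtype.val_injective
    have hle : ((q.support.map Subtype.val : List V) : Multiset V) ≤ C.val := by
      rw [Multiset.le_iff_subset (Multiset.coe_nodup.2 hnodup)]
      intro z hz
      obtain ⟨w, -, rfl⟩ := List.mem_map.1 (Multiset.mem_coe.1 hz)
      exact w.2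
    obtain ⟨R, hR⟩ := Multiset.le_iff_exists_add.1 hle
    have hwalk := rel_step_support (q.map (SimpleGraph.Embedding.induce (C : Set V)).toHom)
      (x := x) (r := r) hyx.symm hyr
    rw [SimpleGraph.Walk.support_map] at hwalk
    rw [Finset.insert_val_of_notMem hxC, Finset.insert_val_of_notMem hrC, hR,
      ← Multiset.cons_add, ← Multiset.cons_add]
    exact hwalk.add (rel_step_refl R)

lemma Guardable.union [DecidableEq V] {S A : Finset V} {k m : ℕ} (hS : Guardable G S k)
    (hA : Guardable G A m) (hd : Disjoint S A) : Guardable G (S ∪ A) (k + m) := by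
  obtain ⟨F, ⟨D₀, hD₀⟩, hF⟩ := hS
  obtain ⟨E, ⟨B₀, hB₀⟩, hE⟩ := hA
  have hval : ∀ D ∈ F, ∀ B ∈ E, Disjoint D B ∧ (D ∪ B).val = D.val + B.val := by
    intro D hD B hB
    have := Finset.disjoint_of_subset_left (hF D hD).2.1
      (Finset.disjoint_of_subset_right (hE B hB).2.1 hd)
    exact ⟨this, by rw [← Finset.disjUnion_eq_union D B this, Finset.disjUnion_val]⟩
  refine ⟨{X | ∃ D ∈ F, ∃ B ∈ E, X = D ∪ B}, ⟨_, D₀, hD₀, B₀, hB₀, rfl⟩, ?_⟩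
  rintro _ ⟨D, hD, B, hB, rfl⟩
  obtain ⟨hDB, hDBv⟩ := hval D hD B hB
  refine ⟨by rw [Finset.card_union_of_disjoint hDB, (hF D hD).1, (hE B hB).1],
    Finset.union_subset_union (hF D hD).2.1 (hE B hB).2.1, fun r hr hrn => ?_⟩
  rw [Finset.mem_union, not_or] at hrn
  rcases Finset.mem_union.1 hr with hr | hr
  · obtain ⟨D', hD', hrel, hrD'⟩ := (hF D hD).2.2 r hr hrn.1
    refine ⟨_, ⟨D', hD', B, hB, rfl⟩, ?_, Finset.mem_union_left _ hrD'⟩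
    rw [hDBv, (hval D' hD' B hB).2]
    exact hrel.add (rel_step_refl _)
  · obtain ⟨B', hB', hrel, hrB'⟩ := (hE B hB).2.2 r hr hrn.2
    refine ⟨_, ⟨D, hD, B', hB', rfl⟩, ?_, Finset.mem_union_right _ hrB'⟩
    rw [hDBv, (hval D hD B' hB').2]
    exact (rel_step_refl _).add hrel

lemma exists_guardable_of_connected [DecidableEq V] {A : Finset V}
    (hA : (G.induce (A : Set V)).Connected) : ∃ k ≤ partWeight G A, Guardable G A k := by
  by_cases hcl : G.IsClique (A : Set V)
  · obtain ⟨x⟩ := hA.nonempty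
    exact ⟨1, (partWeight_of_isClique hcl).ge, guardable_of_isClique ⟨x.1, x.2⟩ hcl⟩
  · obtain ⟨C, hC, hw⟩ := exists_isConnDomOn_of_connected hA hcl
    rw [hw]
    exact hC.exists_guardable

lemma exists_guardable_biUnion [DecidableEq V] (Q : Finset (Finset V))
    (hd : (Q : Set (Finset V)).PairwiseDisjoint id)
    (hQ : ∀ A ∈ Q, (G.induce (A : Set V)).Connected) :
    ∃ k ≤ ∑ A ∈ Q, partWeight G A, Guardable G (Q.biUnion id) k := by
  induction Q using Finset.induction_on with
  | empty =>
    refine ⟨0, Nat.zero_le _, {∅}, ⟨∅, rfl⟩, ?_⟩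
    rintro _ rfl
    simp
  | insert A Q hAQ ih =>
    rw [Finset.coe_insert, Set.pairwiseDisjoint_insert_of_notMem (by exact_mod_cast hAQ)] at hd
    obtain ⟨k, hk, hg⟩ := ih hd.1 fun B hB => hQ B (Finset.mem_insert_of_mem hB)
    obtain ⟨m, hm, hgA⟩ := exists_guardable_of_connected (hQ A (Finset.mem_insert_self A Q))
    rw [Finset.sum_insert hAQ, Finset.biUnion_insert]
    refine ⟨m + k, by omega, hgA.union hg ?_⟩
    rw [Finset.disjoint_biUnion_right]
    exact fun B hB => hd.2 B hB

lemma HasColonization.exists_guardable [DecidableEq V] {S : Finset V} {k : ℕ}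
    (h : HasColonization G S k) : ∃ m ≤ k, Guardable G S m := by
  obtain ⟨P, hP, hw⟩ := h
  obtain ⟨m, hm, hg⟩ := exists_guardable_biUnion P.parts P.disjoint hP
  rw [P.biUnion_parts] at hg
  exact ⟨m, hm.trans hw, hg⟩

lemma exists_map_eq_of_rel {R : V → V → Prop} {s t : Multiset V} (h : Multiset.Rel R s t)
    (hs : s.Nodup) : ∃ f : V → V, s.map f = t ∧ ∀ x ∈ s, R x (f x) := by
  classical
  induction h with
  | zero => exact ⟨id, rfl, by simp⟩
  | @cons a b s t hab _ ih =>
    rw [Multiset.nodup_cons] at hs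
    obtain ⟨f, hf, hR⟩ := ih hs.2
    have hupd : ∀ x ∈ s, Function.update f a b x = f x := fun x hx =>
      Function.update_of_ne (fun h : x = a => hs.1 (h ▸ hx)) _ _
    refine ⟨Function.update f a b, ?_, ?_⟩
    · rw [Multiset.map_cons, Function.update_self, Multiset.map_congr rfl hupd, hf]
    · intro x hx
      rcases Multiset.mem_cons.1 hx with rfl | hx
      · rwa [Function.update_self]
      · rw [hupd x hx]
        exact hR x hx

lemma canMove_of_rel {D D' : Finset V} (h : Multiset.Rel (Step G) D.val D'.val) :
    CanMove G D D' := by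
  obtain ⟨f, hf, hstep⟩ := exists_map_eq_of_rel h D.nodup
  refine ⟨f, ⟨?_, ?_, ?_⟩, fun v hv => (hstep v hv).imp Eq.symm id⟩
  · intro x hx
    have : f x ∈ D.val.map f := Multiset.mem_map_of_mem f hx
    rwa [hf] at this
  · intro x hx y hy hxy
    exact Multiset.inj_on_of_nodup_map (hf ▸ D'.nodup) x hx y hy hxy
  · intro y hy
    have hy' : y ∈ D'.val := hy
    rw [← hf] at hy'
    obtain ⟨x, hx, hxy⟩ := Multiset.mem_map.1 hy'
    exact ⟨x, hx, hxy⟩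

lemma rel_of_canMove {D D' : Finset V} (h : CanMove G D D') :
    Multiset.Rel (Step G) D.val D'.val := by
  obtain ⟨f, hf, hstep⟩ := h
  have hval : D'.val = D.val.map f := by
    refine (Multiset.Nodup.ext D'.nodup (Multiset.Nodup.map_on hf.injOn D.nodup)).2 fun y => ?_
    rw [Multiset.mem_map]
    exact ⟨fun hy => hf.surjOn hy, fun ⟨x, hx, hxy⟩ => hxy ▸ hf.mapsTo hx⟩
  rw [hval, Multiset.rel_map_right]
  exact Multiset.rel_refl_of_refl_on fun x hx => (hstep x hx).imp Eq.symm id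

lemma Guardable.exists_isWinning [Fintype V] {k : ℕ} (h : Guardable G Finset.univ k) :
    ∃ σ : List V → Finset V, IsWinning G σ ∧ (σ []).card = k := by
  obtain ⟨F, ⟨D₀, hD₀⟩, hF⟩ := h
  have hnext : ∀ (D : Finset V) (r : V), ∃ D' : Finset V, D ∈ F → D' ∈ F ∧
      (r ∉ D → Multiset.Rel (Step G) D.val D'.val ∧ r ∈ D') := by
    intro D r
    by_cases hD : D ∈ F
    · by_cases hr : r ∈ D
      · exact ⟨D, fun _ => ⟨hD, fun h => absurd hr h⟩⟩
      · obtain ⟨D', hD', hrel⟩ := (hF D hD).2.2 r (Finset.mem_univ r) hr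
        exact ⟨D', fun _ => ⟨hD', fun _ => hrel⟩⟩
    · exact ⟨D, fun h => absurd h hD⟩
  choose next hn using hnext
  let σ : List V → Finset V := fun h => h.foldr (fun r D => next D r) D₀
  have hσ : ∀ h, σ h ∈ F := by
    intro h
    induction h with
    | nil => exact hD₀
    | cons r h ih => exact (hn (σ h) r ih).1
  have hmove : ∀ h r, r ∉ σ h →
      Multiset.Rel (Step G) (σ h).val (σ (r :: h)).val ∧ r ∈ σ (r :: h) :=
    fun h r hr => (hn (σ h) r (hσ h)).2 hr
  refine ⟨σ, fun h _ => ⟨fun u hu => ?_, fun r hr => ?_⟩, (hF D₀ hD₀).1⟩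
  -- Domination is automatic: an unoccupied `u` could be attacked, so some guard is adjacent to it.
  · obtain ⟨hrel, hu'⟩ := hmove h u hu
    obtain ⟨x, hx, hxu⟩ := Multiset.exists_mem_of_rel_of_mem (Multiset.rel_flip.2 hrel) hu'
    exact ⟨x, hx, hxu.resolve_left fun hxu => hu (hxu ▸ hx)⟩
  · exact ⟨canMove_of_rel (hmove h r hr).1, (hmove h r hr).2⟩

lemma IsWinning.defendable [Fintype V] {σ : List V → Finset V} (h : IsWinning G σ) :
    Defendable G Finset.univ (σ []).card := by
  have hcard : ∀ l, LegalHistory σ l → (σ l).card = (σ []).card := by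
    intro l hl
    induction hl with
    | nil => rfl
    | @cons l r hl hr ih =>
      rw [← ih]
      exact (Multiset.card_eq_card_of_rel (rel_of_canMove ((h l hl).2 r hr).1)).symm
  refine ⟨{D | ∃ l, LegalHistory σ l ∧ D = (σ l).val}, ⟨_, [], .nil, rfl⟩, ?_⟩
  rintro _ ⟨l, hl, rfl⟩
  refine ⟨hcard l hl, fun x _ => Finset.mem_univ x, fun r _ hr => ?_⟩
  obtain ⟨hmove, hr'⟩ := (h l hl).2 r hr
  exact ⟨_, ⟨r :: l, .cons hl hr, rfl⟩, rel_of_canMove hmove, hr'⟩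

lemma HasColonization.mEternalDomNum_le [Fintype V] [DecidableEq V] {k : ℕ}
    (h : HasColonization G Finset.univ k) : mEternalDomNum G ≤ k := by
  obtain ⟨m, hm, hg⟩ := h.exists_guardable
  exact (Nat.sInf_le hg.exists_isWinning).trans hm

lemma hasColonization_mEternalDomNum [Fintype V] [DecidableEq V] (hG : G.IsTree) :
    HasColonization G Finset.univ (mEternalDomNum G) := by
  have hconn : (G.induce ((Finset.univ : Finset V) : Set V)).Connected := by
    rw [Finset.coe_univ]
    exact (SimpleGraph.induceUnivIso G).connected_iff.2 hG.connected
  -- The one-part colonization shows that some winning strategy exists, so the infimum is attained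
  -- rather than being the default 0.
  have hcol : HasColonization G Finset.univ (0 + partWeight G Finset.univ) :=
    HasColonization.union (S := ∅) ⟨Finpartition.empty _, by simp, by simp⟩ hconn
      (Finset.disjoint_empty_left _) (Finset.empty_union _)
  obtain ⟨m, -, hg⟩ := hcol.exists_guardable
  obtain ⟨σ, hσ, hcard⟩ := Nat.sInf_mem (s := {k | ∃ σ : List V → Finset V,
    IsWinning G σ ∧ (σ []).card = k}) ⟨m, hg.exists_isWinning⟩
  have := hσ.defendable.hasColonization hG.isAcyclic hconn
  rwa [hcard] at this

end Strategy

end EternalDomination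

namespace EternalDomination

/-! ### Independence numbers under peeling -/

section Independence

variable {V : Type*} [DecidableEq V] {G : SimpleGraph V}

open Classical in
/-- The independence number of the subgraph induced by `S`. -/
noncomputable def indepNumOn (G : SimpleGraph V) (S : Finset V) : ℕ :=
  (S.powerset.filter fun I : Finset V => G.IsIndepSet (I : Set V)).sup Finset.card

lemma card_le_indepNumOn {S I : Finset V} (hIS : I ⊆ S) (hI : G.IsIndepSet (I : Set V)) :
    I.card ≤ indepNumOn G S := by
  classical
  exact Finset.le_sup (f := Finset.card)
    (Finset.mem_filter.2 ⟨Finset.mem_powerset.2 hIS, hI⟩)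

lemma exists_card_eq_indepNumOn (G : SimpleGraph V) (S : Finset V) :
    ∃ I ⊆ S, G.IsIndepSet (I : Set V) ∧ I.card = indepNumOn G S := by
  classical
  obtain ⟨I, hI, heq⟩ := Finset.exists_mem_eq_sup
    (S.powerset.filter fun I : Finset V => G.IsIndepSet (I : Set V))
    ⟨∅, Finset.mem_filter.2 ⟨Finset.empty_mem_powerset S, by simp [SimpleGraph.IsIndepSet]⟩⟩
    Finset.card
  rw [Finset.mem_filter, Finset.mem_powerset] at hI
  exact ⟨I, hI.1, hI.2, by rw [indepNumOn]; convert heq.symm⟩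

lemma indepNumOn_univ [Fintype V] : indepNumOn G Finset.univ = G.indepNum := by
  refine le_antisymm ?_ ?_
  · obtain ⟨I, -, hI, hc⟩ := exists_card_eq_indepNumOn G Finset.univ
    exact hc ▸ hI.card_le_indepNum
  · obtain ⟨I, hI⟩ := G.exists_isNIndepSet_indepNum
    exact hI.card_eq ▸ card_le_indepNumOn (Finset.subset_univ I) hI.isIndepSet

lemma indepNumOn_le_card (S : Finset V) : indepNumOn G S ≤ S.card := by
  obtain ⟨I, hIS, -, hc⟩ := exists_card_eq_indepNumOn G S
  exact hc ▸ Finset.card_le_card hIS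

lemma card_inter_le_one_of_isClique {A I : Finset V} (hA : G.IsClique (A : Set V))
    (hI : G.IsIndepSet (I : Set V)) : (A ∩ I).card ≤ 1 := by
  rw [Finset.card_le_one]
  intro a ha b hb
  rw [Finset.mem_inter] at ha hb
  by_contra hab
  exact hI ha.2 hb.2 hab (hA ha.1 hb.1 hab)

lemma indepNumOn_le_one_of_isClique {A : Finset V} (hA : G.IsClique (A : Set V)) :
    indepNumOn G A ≤ 1 := by
  obtain ⟨I, hIA, hI, hc⟩ := exists_card_eq_indepNumOn G A
  rw [← hc, ← Finset.inter_eq_right.2 hIA]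
  exact card_inter_le_one_of_isClique hA hI

lemma indepNumOn_le_add {S A B : Finset V} (h : S ⊆ A ∪ B) :
    indepNumOn G S ≤ indepNumOn G A + indepNumOn G B := by
  obtain ⟨I, hIS, hI, hc⟩ := exists_card_eq_indepNumOn G S
  have h1 : (I ∩ A).card ≤ indepNumOn G A :=
    card_le_indepNumOn Finset.inter_subset_right (hI.mono (by simp))
  have h2 : (I ∩ B).card ≤ indepNumOn G B :=
    card_le_indepNumOn Finset.inter_subset_right (hI.mono (by simp))
  have h3 : I.card ≤ (I ∩ A).card + (I ∩ B).card := by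
    refine (Finset.card_le_card ?_).trans (Finset.card_union_le _ _)
    grind
  omega

lemma card_add_indepNumOn_le {S S' L : Finset V} (hS' : S' ⊆ S) (hL : L ⊆ S)
    (hd : Disjoint L S') (hLi : ∀ w ∈ L, ∀ x ∈ L ∪ S', ¬ G.Adj w x) :
    L.card + indepNumOn G S' ≤ indepNumOn G S := by
  obtain ⟨I, hIS, hI, hc⟩ := exists_card_eq_indepNumOn G S'
  rw [← hc, ← Finset.card_union_of_disjoint (Finset.disjoint_of_subset_right hIS hd)]
  refine card_le_indepNumOn (Finset.union_subset hL (hIS.trans hS')) ?_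
  intro a ha b hb hab hadj
  rw [Finset.mem_coe, Finset.mem_union] at ha hb
  rcases ha with ha | ha
  · exact hLi a ha b (by grind) hadj
  · rcases hb with hb | hb
    · exact hLi b hb a (by grind) hadj.symm
    · exact hI ha hb hab hadj

lemma IsMultiStem.card_add_indepNumOn_le {S L : Finset V} {v u : V} (h : IsMultiStem G S L v u) :
    L.card + indepNumOn G ((S \ L).erase v) ≤ indepNumOn G S := by
  have hLS := h.subset
  have hvL := h.notMem
  refine EternalDomination.card_add_indepNumOn_le (by grind) hLS ?_ ?_
  · rw [Finset.disjoint_left]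
    grind
  · intro w hw x hx hwx
    have := h.leaf w hw x (by grind) hwx
    grind

lemma IsSimpleStem.indepNumOn_add_one_le {S : Finset V} {v l u : V}
    (h : IsSimpleStem G S v l u) :
    indepNumOn G (S \ {v, l}) + 1 ≤ indepNumOn G S := by
  have := EternalDomination.card_add_indepNumOn_le (G := G) (S := S) (S' := S \ {v, l}) (L := {l})
    Finset.sdiff_subset (by simpa using h.mem_leaf) (by simp) (by
      intro w hw x hx hwx
      obtain rfl := Finset.mem_singleton.1 hw
      have hne := hwx.ne
      have hl := h.mem_leaf
      have := h.leaf x (by grind) hwx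
      grind)
  rw [Finset.card_singleton] at this
  omega

end Independence

/-! ### Partitions into edges and at most one P₃ -/

section Matchings

variable {V : Type*} {G : SimpleGraph V}

lemma nonempty_induce_iso_iff {W : Type*} {H : SimpleGraph W} {A : Set V} :
    Nonempty (G.induce A ≃g H) ↔ ∃ f : H ↪g G, Set.range f = A := by
  constructor
  · rintro ⟨e⟩
    refine ⟨(SimpleGraph.Embedding.induce A).comp e.symm.toEmbedding, ?_⟩
    ext x
    constructor
    · rintro ⟨w, rfl⟩
      exact (e.symm w).2
    · intro hx
      exact ⟨e ⟨x, hx⟩, congrArg Subtype.val (e.symm_apply_apply ⟨x, hx⟩)⟩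
  · rintro ⟨f, rfl⟩
    let e : H ≃g G.induce (Set.range f) :=
      { toEquiv := Equiv.ofInjective f f.injective
        map_rel_iff' := f.map_rel_iff }
    exact ⟨e.symm⟩

variable [DecidableEq V]

lemma inducesK2_iff {A : Finset V} :
    InducesK2 G A ↔ ∃ x y, G.Adj x y ∧ A = {x, y} := by
  rw [InducesK2, nonempty_induce_iso_iff]
  constructor
  · rintro ⟨f, hf⟩
    refine ⟨f 0, f 1, f.map_adj_iff.2 (by simp), ?_⟩
    rw [← Finset.coe_inj, ← hf]
    ext z
    simp [Fin.exists_fin_two, eq_comm]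
  · rintro ⟨x, y, hxy, rfl⟩
    have hne := hxy.ne
    refine ⟨⟨⟨![x, y], ?_⟩, ?_⟩, ?_⟩
    · intro i j hij
      fin_cases i <;> fin_cases j <;> simp_all
    · intro i j
      change G.Adj (![x, y] i) (![x, y] j) ↔ (⊤ : SimpleGraph (Fin 2)).Adj i j
      fin_cases i <;> fin_cases j <;> simp [hxy, hxy.symm]
    · ext z
      change (∃ i, ![x, y] i = z) ↔ _
      simp [Fin.exists_fin_two, eq_comm]

lemma inducesP3_iff {A : Finset V} :
    InducesP3 G A ↔ ∃ a v b, a ≠ b ∧ G.Adj v a ∧ G.Adj v b ∧ ¬ G.Adj a b ∧ A = {a, v, b} := by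
  rw [InducesP3, nonempty_induce_iso_iff]
  constructor
  · rintro ⟨f, hf⟩
    refine ⟨f 0, f 1, f 2, fun h => absurd (f.injective h) (by decide),
      f.map_adj_iff.2 (by simp [SimpleGraph.pathGraph_adj]),
      f.map_adj_iff.2 (by simp [SimpleGraph.pathGraph_adj]),
      fun h => absurd (f.map_adj_iff.1 h) (by simp [SimpleGraph.pathGraph_adj]), ?_⟩
    rw [← Finset.coe_inj, ← hf]
    ext z
    simp [Fin.exists_fin_succ, eq_comm]
  · rintro ⟨a, v, b, hab, hva, hvb, hn, rfl⟩
    have hva' := hva.ne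
    have hvb' := hvb.ne
    have hn' : ¬ G.Adj b a := fun h => hn h.symm
    refine ⟨⟨⟨![a, v, b], ?_⟩, ?_⟩, ?_⟩
    · intro i j hij
      fin_cases i <;> fin_cases j <;> simp_all
    · intro i j
      change G.Adj (![a, v, b] i) (![a, v, b] j) ↔ (SimpleGraph.pathGraph 3).Adj i j
      fin_cases i <;> fin_cases j <;>
        simp [SimpleGraph.pathGraph_adj, hva, hvb, hva.symm, hvb.symm, hn, hn']
    · ext z
      change (∃ i, ![a, v, b] i = z) ↔ _
      simp [Fin.exists_fin_succ, eq_comm]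

lemma InducesK2.card_eq {A : Finset V} (h : InducesK2 G A) : A.card = 2 := by
  obtain ⟨x, y, hxy, rfl⟩ := inducesK2_iff.1 h
  exact Finset.card_pair hxy.ne

lemma InducesP3.card_eq {A : Finset V} (h : InducesP3 G A) : A.card = 3 := by
  obtain ⟨a, v, b, hab, hva, hvb, -, rfl⟩ := inducesP3_iff.1 h
  exact Finset.card_eq_three.2 ⟨a, v, b, hva.ne.symm, hab, hvb.ne, rfl⟩

lemma InducesK2.connected {A : Finset V} (h : InducesK2 G A) :
    (G.induce (A : Set V)).Connected := by
  obtain ⟨x, y, hxy, rfl⟩ := inducesK2_iff.1 h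
  exact connected_pair hxy

lemma InducesP3.connected {A : Finset V} (h : InducesP3 G A) :
    (G.induce (A : Set V)).Connected := by
  obtain ⟨a, v, b, -, hva, hvb, -, rfl⟩ := inducesP3_iff.1 h
  exact connected_insert (connected_pair hvb) (by simp) hva.symm

lemma InducesK2.isClique {A : Finset V} (h : InducesK2 G A) : G.IsClique (A : Set V) :=
  isClique_of_connected_of_card_le_two h.connected h.card_eq.le

lemma InducesP3.not_isClique {A : Finset V} (h : InducesP3 G A) : ¬ G.IsClique (A : Set V) := by
  obtain ⟨a, v, b, hab, -, -, hn, rfl⟩ := inducesP3_iff.1 h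
  exact fun hcl => hn (hcl (by simp) (by simp) hab)

lemma InducesK2.partWeight_eq {A : Finset V} (h : InducesK2 G A) : partWeight G A = 1 :=
  partWeight_of_isClique h.isClique

lemma InducesP3.partWeight_eq {A : Finset V} (h : InducesP3 G A) : partWeight G A = 2 := by
  refine le_antisymm ?_ (two_le_partWeight h.connected h.not_isClique)
  obtain ⟨a, v, b, -, hva, hvb, -, rfl⟩ := inducesP3_iff.1 h
  refine partWeight_le_of_isConnDomOn (C := {v}) ⟨by simp, ?_, connected_singleton v⟩
  intro u hu huv
  refine ⟨v, by simp, ?_⟩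
  simp only [Finset.mem_insert, Finset.mem_singleton] at hu huv
  rcases hu with rfl | rfl | rfl
  · exact hva
  · exact absurd rfl huv
  · exact hvb

lemma card_inter_le_partWeight {A I : Finset V} (h : InducesK2 G A ∨ InducesP3 G A)
    (hI : G.IsIndepSet (I : Set V)) : (A ∩ I).card ≤ partWeight G A := by
  rcases h with h | h
  · rw [h.partWeight_eq]
    exact card_inter_le_one_of_isClique h.isClique hI
  · rw [h.partWeight_eq]
    by_contra! h3
    have hAI : A ∩ I = A :=
      Finset.eq_of_subset_of_card_le Finset.inter_subset_left (by rw [h.card_eq]; omega)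
    obtain ⟨a, v, b, -, hva, -, -, rfl⟩ := inducesP3_iff.1 h
    rw [Finset.inter_eq_left] at hAI
    exact hI (hAI (by simp)) (hAI (by simp)) hva.ne hva

/-- The vertices in `S` can be partitioned into edges. -/
def HasPerfectMatchingOn (G : SimpleGraph V) (S : Finset V) : Prop :=
  ∃ P : Finpartition S, ∀ A ∈ P.parts, InducesK2 G A

/-- All parts of the partition `P` induce a `K₂` or a `P₃`, and at most one induces a `P₃`. -/
def IsNearMatching (G : SimpleGraph V) {S : Finset V} (P : Finpartition S) : Prop :=
  (∀ A ∈ P.parts, InducesK2 G A ∨ InducesP3 G A) ∧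
    {A | A ∈ P.parts ∧ InducesP3 G A}.Subsingleton

lemma IsNearMatching.two_mul_sum_le {S : Finset V} {P : Finpartition S}
    (h : IsNearMatching G P) : 2 * ∑ A ∈ P.parts, partWeight G A ≤ S.card + 1 := by
  classical
  -- Twice the weight equals the size for an edge (2 = 2) and exceeds it by one for a P₃ (4 = 3 +
  -- 1).
  have h1 : ∀ A ∈ P.parts, 2 * partWeight G A = A.card + if InducesP3 G A then 1 else 0 := by
    intro A hA
    split_ifs with h3
    · rw [h3.partWeight_eq, h3.card_eq]
    · have h2 := (h.1 A hA).resolve_right h3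
      rw [h2.partWeight_eq, h2.card_eq]
  have h2 : (P.parts.filter fun A => InducesP3 G A).card ≤ 1 := by
    rw [Finset.card_le_one]
    intro A hA B hB
    exact h.2 (Finset.mem_filter.1 hA) (Finset.mem_filter.1 hB)
  rw [Finset.mul_sum, Finset.sum_congr rfl h1, Finset.sum_add_distrib, P.sum_card_parts,
    ← Finset.card_filter]
  omega

lemma card_le_sum_partWeight {S : Finset V} {P : Finpartition S}
    (h : ∀ A ∈ P.parts, InducesK2 G A ∨ InducesP3 G A) {I : Finset V} (hIS : I ⊆ S)
    (hI : G.IsIndepSet (I : Set V)) : I.card ≤ ∑ A ∈ P.parts, partWeight G A := by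
  have hsub : I ⊆ P.parts.biUnion (· ∩ I) := by
    intro x hx
    obtain ⟨A, hA, hxA⟩ := P.exists_mem (hIS hx)
    exact Finset.mem_biUnion.2 ⟨A, hA, Finset.mem_inter.2 ⟨hxA, hx⟩⟩
  calc I.card ≤ (P.parts.biUnion (· ∩ I)).card := Finset.card_le_card hsub
    _ ≤ ∑ A ∈ P.parts, (A ∩ I).card := Finset.card_biUnion_le
    _ ≤ _ := Finset.sum_le_sum fun A hA => card_inter_le_partWeight (h A hA) hI

lemma InducesK2.not_inducesP3 {A : Finset V} (h : InducesK2 G A) : ¬ InducesP3 G A := by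
  intro h3
  have := h.card_eq
  have := h3.card_eq
  omega

lemma InducesK2.nonempty {A : Finset V} (h : InducesK2 G A) : A.Nonempty :=
  Finset.card_pos.1 (by rw [h.card_eq]; omega)

lemma InducesP3.nonempty {A : Finset V} (h : InducesP3 G A) : A.Nonempty :=
  Finset.card_pos.1 (by rw [h.card_eq]; omega)

lemma HasPerfectMatchingOn.union {S A S' : Finset V} (h : HasPerfectMatchingOn G S)
    (hA : InducesK2 G A) (hd : Disjoint S A) (hS' : S ∪ A = S') :
    HasPerfectMatchingOn G S' := by
  obtain ⟨P, hP⟩ := h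
  obtain ⟨-, P', hP'⟩ := exists_finpartition_insert P hA.nonempty hd hS'
  refine ⟨P', ?_⟩
  rw [hP']
  intro B hB
  rcases Finset.mem_insert.1 hB with rfl | hB
  · exact hA
  · exact hP B hB

lemma IsNearMatching.union {S A S' : Finset V} {P : Finpartition S} (h : IsNearMatching G P)
    (hA : InducesK2 G A) (hd : Disjoint S A) (hS' : S ∪ A = S') :
    ∃ P' : Finpartition S', IsNearMatching G P' := by
  obtain ⟨-, P', hP'⟩ := exists_finpartition_insert P hA.nonempty hd hS'
  refine ⟨P', ?_, ?_⟩
  · rw [hP']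
    intro B hB
    rcases Finset.mem_insert.1 hB with rfl | hB
    · exact Or.inl hA
    · exact h.1 B hB
  · rw [hP']
    refine h.2.anti fun B hB => ⟨(Finset.mem_insert.1 hB.1).resolve_left ?_, hB.2⟩
    rintro rfl
    exact hA.not_inducesP3 hB.2

lemma HasPerfectMatchingOn.exists_isNearMatching {S A S' : Finset V}
    (h : HasPerfectMatchingOn G S) (hA : InducesP3 G A) (hd : Disjoint S A) (hS' : S ∪ A = S') :
    ∃ P' : Finpartition S', IsNearMatching G P' := by
  obtain ⟨P, hP⟩ := h
  obtain ⟨-, P', hP'⟩ := exists_finpartition_insert P hA.nonempty hd hS'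
  refine ⟨P', ?_, ?_⟩
  · rw [hP']
    intro B hB
    rcases Finset.mem_insert.1 hB with rfl | hB
    · exact Or.inr hA
    · exact Or.inl (hP B hB)
  · rw [hP']
    have key : ∀ B ∈ insert A P.parts, InducesP3 G B → B = A := fun B hB h3 =>
      (Finset.mem_insert.1 hB).resolve_right fun hB => (hP B hB).not_inducesP3 h3
    intro B hB C hC
    rw [key B hB.1 hB.2, key C hC.1 hC.2]

lemma HasPerfectMatchingOn.empty : HasPerfectMatchingOn G ∅ :=
  ⟨Finpartition.empty _, by simp⟩

lemma IsMultiStem.inducesP3 {S L : Finset V} {v u : V}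
    (h : IsMultiStem G S L v u) (hL : L.card = 2) : InducesP3 G (insert v L) := by
  obtain ⟨a, b, hab, rfl⟩ := Finset.card_eq_two.1 hL
  refine inducesP3_iff.2 ⟨a, v, b, hab, h.adj a (by simp), h.adj b (by simp), ?_, by grind⟩
  intro hadj
  have hb := h.leaf a (by simp) b (h.subset (by simp)) hadj
  exact h.notMem (by simp [hb])

end Matchings

/-! ### Weight against independence number -/

section Comparison

variable {V : Type*} [DecidableEq V] {G : SimpleGraph V}

/-- The comparison of minimum-weight colonizations with independent sets in a tree: the weight is
at most the independence number, with equality only if there is a partition into edges and at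
most one path on three vertices. -/
theorem colonization_indepNumOn (hG : G.IsAcyclic) {S : Finset V}
    (hS : (G.induce (S : Set V)).Connected) :
    S.card ≤ 2 * indepNumOn G S ∧ HasColonization G S (indepNumOn G S) ∧
      (2 * indepNumOn G S ≤ S.card → HasPerfectMatchingOn G S) ∧
      ((∃ k < indepNumOn G S, HasColonization G S k) ∨ 2 * indepNumOn G S ≤ S.card + 1 ∧
        (S.card = 1 ∨ ∃ P : Finpartition S, IsNearMatching G P)) := by
  -- The perfect-matching clause is carried along because the multi-stem case applies it after
  -- deleting the stem as well. Singletons are exempted in the last clause, being neither K₂ nor P₃.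
  induction h : S.card using Nat.strong_induction_on generalizing S with
  | _ n ih =>
  subst h
  rcases le_or_gt S.card 2 with h2 | h3
  · have hcl := isClique_of_connected_of_card_le_two hS h2
    obtain ⟨x⟩ := hS.nonempty
    have h1 : indepNumOn G S = 1 := by
      refine le_antisymm (indepNumOn_le_one_of_isClique hcl) ?_
      exact card_le_indepNumOn (I := {x.1}) (by simp) (by simp [SimpleGraph.IsIndepSet])
    have hpos : 0 < S.card := Finset.card_pos.2 ⟨x.1, x.2⟩
    have hK2 : S.card = 2 → InducesK2 G S := by
      intro hc
      obtain ⟨a, b, hab, rfl⟩ := Finset.card_eq_two.1 hc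
      exact inducesK2_iff.2 ⟨a, b, hcl (by simp) (by simp) hab, rfl⟩
    have hPM : S.card = 2 → HasPerfectMatchingOn G S := fun hc =>
      HasPerfectMatchingOn.empty.union (hK2 hc) (Finset.disjoint_empty_left _)
        (Finset.empty_union S)
    rw [h1]
    refine ⟨by omega, hasColonization_one hS hcl, fun hc => hPM (by omega),
      Or.inr ⟨by omega, ?_⟩⟩
    by_cases hc : S.card = 1
    · exact Or.inl hc
    · right
      obtain ⟨P, hP⟩ := hPM (by omega)
      refine ⟨P, fun A hA => Or.inl (hP A hA), ?_⟩
      intro A hA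
      exact absurd hA.2 (hP A hA.1).not_inducesP3
  · rcases exists_isMultiStem_or_isSimpleStem hG hS h3 with ⟨L, v, u, hst⟩ | ⟨v, l, u, hst⟩
    · have hL2 := hst.two_le
      have hvS : v ∈ S \ L := by simp [hst.mem, hst.notMem]
      have hc1 : (S \ L).card = S.card - L.card := Finset.card_sdiff_of_subset hst.subset
      have hcL : L.card ≤ S.card := Finset.card_le_card hst.subset
      have hc2 : ((S \ L).erase v).card + 1 = (S \ L).card := Finset.card_erase_add_one hvS
      have hconn := hst.connected hS
      have hlt' : (S \ L).card < S.card := by omega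
      have hcol' := (ih _ hlt' hconn rfl).2.1
      have hle := hst.card_add_indepNumOn_le
      have hα' : indepNumOn G (S \ L) ≤ 1 + indepNumOn G ((S \ L).erase v) := by
        refine (indepNumOn_le_add (A := {v}) (B := (S \ L).erase v) (by grind)).trans ?_
        have := indepNumOn_le_card (G := G) {v}
        rw [Finset.card_singleton] at this
        omega
      obtain ⟨hcard'', hPM''⟩ : ((S \ L).erase v).card ≤ 2 * indepNumOn G ((S \ L).erase v) ∧
          (2 * indepNumOn G ((S \ L).erase v) ≤ ((S \ L).erase v).card →
            HasPerfectMatchingOn G ((S \ L).erase v)) := by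
        -- Empty when the tree is a star centred at `v`; the induction hypothesis needs a non-empty
        -- set.
        rcases ((S \ L).erase v).eq_empty_or_nonempty with he | hne
        · rw [he]
          exact ⟨by simp, fun _ => HasPerfectMatchingOn.empty⟩
        · have := ih ((S \ L).erase v).card (by omega) (hst.connected_erase hS hne) rfl
          exact ⟨this.1, this.2.2.1⟩
      -- The perfect-matching clause is vacuous here: `hle` and `hcard''` give `2β ≥ |S| + |L| - 1 >
      -- |S|`.
      refine ⟨by omega, (hst.hasColonization hcol').mono (by omega), by omega, ?_⟩
      by_cases hlt : indepNumOn G (S \ L) + 1 < indepNumOn G S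
      · exact Or.inl ⟨_, hlt, hst.hasColonization hcol'⟩
      rcases (ih _ hlt' hconn rfl).2.2.2 with ⟨k, hk, hcol⟩ | ⟨hα2, -⟩
      · exact Or.inl ⟨k + 1, by omega, hst.hasColonization hcol⟩
      · right
        refine ⟨by omega, Or.inr ?_⟩
        have hvL := hst.notMem
        have hLS := hst.subset
        -- With no slack left, `|L| = 2` and `β(S \ L) = 1 + β((S \ L) \ {v})`. So `hα2` makes the
        -- remainder extremal and hence perfectly matched, and `v` with its two leaves is the P₃.
        exact (hPM'' (by omega)).exists_isNearMatching (hst.inducesP3 (by omega))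
          (by rw [Finset.disjoint_left]; grind) (by grind)
    · have hsub : ({v, l} : Finset V) ⊆ S := by
        have := hst.mem
        have := hst.mem_leaf
        grind
      have hpair : ({v, l} : Finset V).card = 2 := Finset.card_pair hst.adj_leaf.ne
      have hc : (S \ {v, l}).card = S.card - 2 := by
        rw [Finset.card_sdiff_of_subset hsub, hpair]
      have hK2 : InducesK2 G {v, l} := inducesK2_iff.2 ⟨v, l, hst.adj_leaf, rfl⟩
      have hun : S \ {v, l} ∪ {v, l} = S := Finset.sdiff_union_of_subset hsub
      obtain ⟨hcard', hcol', hPM', halt'⟩ :=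
        ih (S \ {v, l}).card (by omega) (hst.connected hS) rfl
      have hle := hst.indepNumOn_add_one_le
      have hge : indepNumOn G S ≤ indepNumOn G (S \ {v, l}) + 1 :=
        (indepNumOn_le_add hun.ge).trans
          (Nat.add_le_add_left (indepNumOn_le_one_of_isClique hK2.isClique) _)
      refine ⟨by omega, (hst.hasColonization hcol').mono hle,
        fun h => (hPM' (by omega)).union hK2 Finset.sdiff_disjoint hun, ?_⟩
      rcases halt' with ⟨k, hk, hcol⟩ | ⟨hα2, hc1 | ⟨P, hP⟩⟩
      · exact Or.inl ⟨k + 1, by omega, hst.hasColonization hcol⟩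
      -- The remainder is the single vertex `u`, so `S` is itself the path `l`, `v`, `u`.
      · refine Or.inr ⟨by omega, Or.inr ?_⟩
        have hvu := hst.adj_other.ne
        have hS3 : ({l, v, u} : Finset V) = S := by
          refine Finset.eq_of_subset_of_card_le ?_ ?_
          · have := hst.mem_other
            grind
          · rw [Finset.card_eq_three.2 ⟨l, v, u, hst.adj_leaf.ne.symm, hst.ne, hvu, rfl⟩]
            omega
        have hP3 : InducesP3 G S := by
          refine inducesP3_iff.2 ⟨l, v, u, hst.ne, hst.adj_leaf, hst.adj_other, ?_, hS3.symm⟩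
          intro hlu
          exact hvu (hst.leaf u hst.mem_other hlu).symm
        exact HasPerfectMatchingOn.empty.exists_isNearMatching hP3
          (Finset.disjoint_empty_left _) (Finset.empty_union S)
      · exact Or.inr ⟨by omega, Or.inr (hP.union hK2 Finset.sdiff_disjoint hun)⟩

end Comparison

end EternalDomination

theorem corollary6p7 {V : Type*} [Fintype V] [DecidableEq V] (T : SimpleGraph V)
    (hT : T.IsTree) (hV : 2 ≤ Fintype.card V) :
    EternalDomination.mEternalDomNum T = T.indepNum ↔
      ∃ P : Finpartition (Finset.univ : Finset V),
        EternalDomination.IsMinWeightNeoColonization T P ∧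
        (∀ A ∈ P.parts, EternalDomination.InducesK2 T A ∨ EternalDomination.InducesP3 T A) ∧
        {A | A ∈ P.parts ∧ EternalDomination.InducesP3 T A}.Subsingleton := by
  open EternalDomination in
  have hconn : (T.induce ((Finset.univ : Finset V) : Set V)).Connected := by
    rw [Finset.coe_univ]
    exact (SimpleGraph.induceUnivIso T).connected_iff.2 hT.connected
  obtain ⟨hcard, -, -, halt⟩ := colonization_indepNumOn hT.isAcyclic hconn
  rw [indepNumOn_univ, Finset.card_univ] at hcard halt
  have hweight : ∀ P : Finpartition (Finset.univ : Finset V), IsNearMatching T P →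
      weight T P ≤ T.indepNum := by
    intro P hP
    have := hP.two_mul_sum_le
    rw [Finset.card_univ] at this
    unfold weight
    -- From `2 * weight ≤ n + 1` and `n ≤ 2β` the weight is at most `β + 1/2`, hence at most `β`.
    omega
  constructor
  · intro heq
    rcases halt with ⟨k, hk, hcol⟩ | ⟨-, hc | ⟨P, hP⟩⟩
    · have := hcol.mEternalDomNum_le
      omega
    · omega
    · refine ⟨P, ⟨fun A hA => ?_, fun Q hQ => ?_⟩, hP⟩
      · exact (hP.1 A hA).elim InducesK2.connected InducesP3.connected
      · refine (hweight P hP).trans (heq.ge.trans ?_)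
        exact HasColonization.mEternalDomNum_le ⟨Q, hQ, le_rfl⟩
  · rintro ⟨P, ⟨hneo, hmin⟩, hP⟩
    have hw : weight T P = T.indepNum := by
      refine le_antisymm (hweight P hP) ?_
      obtain ⟨I, hI⟩ := T.exists_isNIndepSet_indepNum
      rw [← hI.card_eq]
      exact card_le_sum_partWeight hP.1 (Finset.subset_univ I) hI.isIndepSet
    rw [← hw]
    refine le_antisymm (HasColonization.mEternalDomNum_le ⟨P, hneo, le_rfl⟩) ?_
    obtain ⟨Q, hQ, hQw⟩ := hasColonization_mEternalDomNum hT
    exact (hmin Q hQ).trans hQw
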